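/- All manifolds are smooth, finite-dimensional, Hausdorff, second countable, non-empty and without boundary. A semi-Riemannian metric is a smooth, symmetric, nondegenerate $(0,2)$-tensor field. Put $\epsilon_1=1$, $\epsilon_2=\epsilon_3=-1$. A *mixed 3-structure* on $M$ is a triple $(\phi_\alpha,\xi_\alpha,\eta_\alpha)_{\alpha=1,2,3}$ of smooth endomorphism fields $\phi_\alpha$ of $TM$, vector fields $\xi_\alpha$ and 1-forms $\eta_\alpha$ such that $\phi_\alpha^2=-\epsilon_\alpha I+\eta_\alpha\otimes\xi_\alpha$, $\eta_\alpha(\xi_\alpha)=\epsilon_\alpha$, $\eta_\alpha(\xi_\beta)=0$ for $\alpha\ne\beta$, and, for every even permutation $(\alpha,\beta,\gamma)$ of $(1,2,3)$, $$\phi_\alpha(\xi_\beta)=-\phi_\beta(\xi_\alpha)=\epsilon_\gamma\xi_\gamma,\qquad \eta_\alpha\circ\phi_\beta=-\eta_\beta\circ\phi_\alpha=\epsilon_\gamma\eta_\gamma,$$ $$\phi_\alpha\phi_\beta-\eta_\beta\otimes\xi_\alpha=-\phi_\beta\phi_\alpha+\eta_\alpha\otimes\xi_\beta=\epsilon_\gamma\phi_\gamma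 .$$ It is a *metric mixed 3-structure* together with a semi-Riemannian metric $g$ if $g(\phi_\alpha X,\phi_\alpha Y)=\epsilon_\alpha g(X,Y)-\eta_\alpha(X)\eta_\alpha(Y)$ and $g(X,\xi_\alpha)=\eta_\alpha(X)$ for all $X,Y$ and $\alpha$. An *almost para-hypercomplex structure* on $P$ is a triple $(J_1,J_2,J_3)$ of smooth endomorphism fields of $TP$ with $J_1^2=-\mathrm{Id}$, $J_2^2=J_3^2=\mathrm{Id}$, $J_2,J_3\neq\pm\mathrm{Id}$ and $J_2J_1=-J_1J_2=J_3$. A semi-Riemannian metric $k$ on $P$ is *para-hyperhermitian* for it if $k(J_\alpha X,J_\alpha Y)=\epsilon_\alpha k(X,Y)$ for $\alpha=1,2,3$; together they form an *almost para-hyperhermitian structure*. **Theorem.** Let $\pi:P\to M$ be a smooth principal $S^1$-bundle over a manifold $M$ with a metric mixed 3-structure $((\phi_\alpha,\xi_\alpha,\eta_\alpha)_{\alpha=1,2,3},g)$. Let $\Theta$ be the fundamental vector field of the $S^1$-action, $\Theta(p)=\frac{d}{dt}\big|_{t=0}e^{it}\cdot p$. Then: 1. $P$ carries an almost para-hyperhermitian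 structure. 2. There is a semi-Riemannian metric $g'$ on $P$ for which $\pi:(P,g')\to(M,g)$ is a semi-Riemannian submersion (a surjective smooth submersion with nondegenerate fibres whose differential is isometric on the horizontal space, the $g'$-orthogonal complement of $\ker d\pi$). 3. For every such $g'$, each tangent vector $X$ of $M$ at $\pi(p)$ has a unique horizontal lift $X^h$ at $p$, and there is exactly one triple $(J_1,J_2,J_3)$ of smooth endomorphism fields of $TP$ with $$J_\alpha X^h=(\phi_\alpha X)^h+\eta_\alpha(X)\Theta,\qquad J_\alpha\Theta=-(\xi_\alpha)^h\qquad(\alpha=1,2,3).$$ It is an almost para-hypercomplex structure. For every semi-Riemannian metric $h$ on $P$ the averaged tensor $$\bar h(X,Y)=\tfrac14\Big[h(X,Y)+\sum_{\alpha=1}^3\epsilon_\alpha h(J_\alpha X,J_\alpha Y)\Big]$$ satisfies $\bar h(J_\alpha X,J_\alpha Y)=\epsilon_\alpha\bar h(X,Y)$, and whenever it is nondegenerate it is a para-hyperhermitian metric, so that $(J_1,J_2,J_3,\bar h)$ is an almost para-hyperhermitian structure. There is at least one semi-Riemannian metric $h$ on $P$ for which this happens. -/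

import Mathlib

open scoped Manifold ContDiff

noncomputable section

namespace ParaHyper

section TensorFields

variable {E : Type*} [NormedAddCommGroup E] [NormedSpace ℝ E]
  {H : Type*} [TopologicalSpace H] (I : ModelWithCorners ℝ E H)
  (M : Type*) [TopologicalSpace M] [ChartedSpace H M] [IsManifold I ∞ M]

/-- Smooth vector fields on `M`. -/
abbrev VectorField := ContMDiffSection I E ∞ (fun x : M => TangentSpace I x)

/-- Smooth 1-forms on `M`. -/
abbrev OneForm :=
  ContMDiffSection I (E →L[ℝ] ℝ) ∞ (fun x : M => TangentSpace I x →L[ℝ] ℝ)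

/-- Smooth tensor fields of type (1,1) on `M`, i.e. smooth fields of endomorphisms of the
tangent spaces. -/
abbrev EndField :=
  ContMDiffSection I (E →L[ℝ] E) ∞ (fun x : M => TangentSpace I x →L[ℝ] TangentSpace I x)

/-- Smooth tensor fields of type (0,2) on `M`. -/
abbrev BilinField :=
  ContMDiffSection I (E →L[ℝ] E →L[ℝ] ℝ) ∞
    (fun x : M => TangentSpace I x →L[ℝ] TangentSpace I x →L[ℝ] ℝ)

/-- A semi-Riemannian metric on `M`: a smooth, symmetric, nondegenerate (0,2)-tensor field.
(Its index is then automatically locally constant.) -/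
structure SemiRiemannianMetric where
  /-- the underlying tensor field -/
  val : BilinField I M
  symm : ∀ (x : M) (u v : TangentSpace I x), val x u v = val x v u
  nondegenerate : ∀ (x : M) (u : TangentSpace I x),
    (∀ v : TangentSpace I x, val x u v = 0) → u = 0

end TensorFields

/-- The signs `ε₁ = 1`, `ε₂ = ε₃ = -1`. The indices 1, 2, 3 are represented by
`0 1 2 : Fin 3`. -/
def eps : Fin 3 → ℝ := ![1, -1, -1]

section Structures

variable {E : Type*} [NormedAddCommGroup E] [NormedSpace ℝ E]
  {H : Type*} [TopologicalSpace H] {I : ModelWithCorners ℝ E H}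
  {M : Type*} [TopologicalSpace M] [ChartedSpace H M] [IsManifold I ∞ M]

/-- `φ² = -ε Id + η ⊗ ξ` and `η(ξ) = ε`: an almost contact structure if `ε = 1`, a Lorentzian
almost paracontact structure if `ε = -1`. -/
structure IsAlmostContactType (ε : ℝ) (φ : EndField I M) (ξ : VectorField I M)
    (η : OneForm I M) : Prop where
  sq : ∀ (x : M) (v : TangentSpace I x), φ x (φ x v) = -(ε • v) + η x v • ξ x
  eta_xi : ∀ x : M, η x (ξ x) = ε

variable (I M) in
/-- A mixed 3-structure `(φ_α, ξ_α, η_α)`, `α = 1, 2, 3`. The even permutations `(α, β, γ)` of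
the three indices are exactly the triples `(a, a + 1, a + 2)` with `a : Fin 3`, the addition
being modulo 3. -/
structure MixedThreeStructure where
  /-- the endomorphism fields -/
  φ : Fin 3 → EndField I M
  /-- the vector fields -/
  ξ : Fin 3 → VectorField I M
  /-- the 1-forms -/
  η : Fin 3 → OneForm I M
  contact : ∀ a, IsAlmostContactType (eps a) (φ a) (ξ a) (η a)
  eta_xi_ne : ∀ a b, a ≠ b → ∀ x : M, η a x (ξ b x) = 0
  phi_xi : ∀ (a : Fin 3) (x : M), φ a x (ξ (a + 1) x) = eps (a + 2) • ξ (a + 2) x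
  phi_xi' : ∀ (a : Fin 3) (x : M), -(φ (a + 1) x (ξ a x)) = eps (a + 2) • ξ (a + 2) x
  eta_phi : ∀ (a : Fin 3) (x : M) (v : TangentSpace I x),
    η a x (φ (a + 1) x v) = eps (a + 2) * η (a + 2) x v
  eta_phi' : ∀ (a : Fin 3) (x : M) (v : TangentSpace I x),
    -(η (a + 1) x (φ a x v)) = eps (a + 2) * η (a + 2) x v
  phi_phi : ∀ (a : Fin 3) (x : M) (v : TangentSpace I x),
    φ a x (φ (a + 1) x v) - η (a + 1) x v • ξ a x = eps (a + 2) • φ (a + 2) x v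
  phi_phi' : ∀ (a : Fin 3) (x : M) (v : TangentSpace I x),
    -(φ (a + 1) x (φ a x v)) + η a x v • ξ (a + 1) x = eps (a + 2) • φ (a + 2) x v

/-- The semi-Riemannian metric `g` is compatible with the mixed 3-structure `S`, i.e. `(S, g)` is
a metric mixed 3-structure. -/
structure MixedThreeStructure.IsCompatible (S : MixedThreeStructure I M)
    (g : SemiRiemannianMetric I M) : Prop where
  phi_phi : ∀ (a : Fin 3) (x : M) (u v : TangentSpace I x),
    g.val x (S.φ a x u) (S.φ a x v) = eps a * g.val x u v - S.η a x u * S.η a x v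
  xi : ∀ (a : Fin 3) (x : M) (u : TangentSpace I x), g.val x u (S.ξ a x) = S.η a x u

/-- `J² = -Id`. -/
def IsAlmostComplex (J : EndField I M) : Prop :=
  ∀ (x : M) (v : TangentSpace I x), J x (J x v) = -v

/-- `J² = Id` and `J ≠ ± Id`. -/
structure IsAlmostProduct (J : EndField I M) : Prop where
  sq : ∀ (x : M) (v : TangentSpace I x), J x (J x v) = v
  ne_id : ¬ ∀ (x : M) (v : TangentSpace I x), J x v = v
  ne_neg_id : ¬ ∀ (x : M) (v : TangentSpace I x), J x v = -v

/-- An almost para-hypercomplex structure `(J₁, J₂, J₃)`:  `J₁` is an almost complex structure,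
`J₂`, `J₃` are almost product structures, and `J₂ J₁ = - J₁ J₂ = J₃`. -/
structure IsAlmostParaHypercomplex (J : Fin 3 → EndField I M) : Prop where
  complex : IsAlmostComplex (J 0)
  product₁ : IsAlmostProduct (J 1)
  product₂ : IsAlmostProduct (J 2)
  mul₁ : ∀ (x : M) (v : TangentSpace I x), J 1 x (J 0 x v) = J 2 x v
  mul₂ : ∀ (x : M) (v : TangentSpace I x), -(J 0 x (J 1 x v)) = J 2 x v

/-- The metric `k` satisfies `k(J_α X, J_α Y) = ε_α k(X, Y)` for `α = 1, 2, 3`. -/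
def IsParaHyperhermitian (J : Fin 3 → EndField I M) (k : SemiRiemannianMetric I M) : Prop :=
  ∀ (a : Fin 3) (x : M) (u v : TangentSpace I x),
    k.val x (J a x u) (J a x v) = eps a * k.val x u v

/-- An almost para-hyperhermitian structure: an almost para-hypercomplex structure together with
a para-hyperhermitian metric. -/
structure IsAlmostParaHyperhermitian (J : Fin 3 → EndField I M)
    (k : SemiRiemannianMetric I M) : Prop where
  hypercomplex : IsAlmostParaHypercomplex J
  hermitian : IsParaHyperhermitian J k

/-- The average `¼ [h(u, v) + ∑_α ε_α h(J_α u, J_α v)]` of a metric `h` over `J₁, J₂, J₃`. -/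
def average (J : Fin 3 → EndField I M) (h : SemiRiemannianMetric I M) (x : M)
    (u v : TangentSpace I x) : ℝ :=
  (1 / 4) * (h.val x u v + ∑ a, eps a * h.val x (J a x u) (J a x v))

end Structures

section Bundles

variable {E : Type*} [NormedAddCommGroup E] [NormedSpace ℝ E]
  {H : Type*} [TopologicalSpace H] (I : ModelWithCorners ℝ E H)
  {M : Type*} [TopologicalSpace M] [ChartedSpace H M]
  {E' : Type*} [NormedAddCommGroup E'] [NormedSpace ℝ E']
  {H' : Type*} [TopologicalSpace H'] (I' : ModelWithCorners ℝ E' H')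
  {P : Type*} [TopologicalSpace P] [ChartedSpace H' P]

/-- `π : P → M` is a smooth principal bundle with structure group `S¹`: the circle acts smoothly
on `P`, and near each point of `M` there is a smooth equivariant local trivialization
`π⁻¹(U) ≃ U × S¹`. (The group is commutative, so left and right actions are the same thing.) -/
structure IsPrincipalCircleBundle [MulAction Circle P] (π : P → M) : Prop where
  smooth : ContMDiff I' I ∞ π
  smooth_action : ContMDiff ((𝓡 1).prod I') I' ∞ (fun q : Circle × P => q.1 • q.2)
  proj_smul : ∀ (z : Circle) (p : P), π (z • p) = π p
  locally_trivial : ∀ x : M, ∃ e : Bundle.Trivialization Circle π, x ∈ e.baseSet ∧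
    ContMDiffOn I' (I.prod (𝓡 1)) ∞ e e.source ∧
    ContMDiffOn (I.prod (𝓡 1)) I' ∞ e.toOpenPartialHomeomorph.symm e.target ∧
    ∀ (z : Circle), ∀ p ∈ e.source, (e (z • p)).2 = z * (e p).2

/-- The fundamental vector field `Θ` of a circle action on `P`: `Θ(p)` is the velocity at `t = 0`
of the curve `t ↦ e^{it} • p`. (The velocity lives at the point `e^{i0} • p`, which equals `p`.) -/
def fundamentalField [MulAction Circle P] (p : P) : TangentSpace I' p :=
  (mfderiv 𝓘(ℝ, ℝ) I' (fun t : ℝ => Circle.exp t • p) 0 (1 : ℝ) : E')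

variable {I I'} [IsManifold I ∞ M] [IsManifold I' ∞ P]

variable (I) in
/-- `u ∈ T_p P` is horizontal: it is orthogonal, with respect to `g'`, to the vertical space
`ker dπ_p`. -/
def IsHorizontal (π : P → M) (g' : SemiRiemannianMetric I' P) (p : P)
    (u : TangentSpace I' p) : Prop :=
  ∀ w : TangentSpace I' p, mfderiv I' I π p w = 0 → g'.val p u w = 0

/-- `π : (P, g') → (M, g)` is a semi-Riemannian submersion: a smooth submersion onto `M` whose
fibres are nondegenerate and whose differential is isometric on horizontal vectors. -/
structure IsSemiRiemannianSubmersion (π : P → M) (g' : SemiRiemannianMetric I' P)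
    (g : SemiRiemannianMetric I M) : Prop where
  smooth : ContMDiff I' I ∞ π
  surjective : Function.Surjective π
  submersion : ∀ p : P, Function.Surjective (mfderiv I' I π p)
  fibre_nondegenerate : ∀ (p : P) (w : TangentSpace I' p), mfderiv I' I π p w = 0 →
    IsHorizontal I π g' p w → w = 0
  isometric : ∀ (p : P) (u v : TangentSpace I' p),
    IsHorizontal I π g' p u → IsHorizontal I π g' p v →
      g.val (π p) (mfderiv I' I π p u) (mfderiv I' I π p v) = g'.val p u v

/-- `u ∈ T_p P` is the horizontal lift of `v ∈ T_{π(p)} M`. -/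
def IsHorizontalLift (π : P → M) (g' : SemiRiemannianMetric I' P) (p : P)
    (v : TangentSpace I (π p)) (u : TangentSpace I' p) : Prop :=
  mfderiv I' I π p u = v ∧ IsHorizontal I π g' p u

/-- The defining equalities `J_α X^h = (φ_α X)^h + η_α(X) Θ` and `J_α Θ = -(ξ_α)^h`, where the
horizontal lift is taken with respect to `g'`; both sides are tensorial in `X`, so the equalities
are written for tangent vectors. -/
structure IsLiftedTriple [MulAction Circle P] (π : P → M) (g' : SemiRiemannianMetric I' P)
    (S : MixedThreeStructure I M) (J : Fin 3 → EndField I' P) : Prop where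
  horizontal : ∀ (a : Fin 3) (p : P) (v : TangentSpace I (π p)) (vh wh : TangentSpace I' p),
    IsHorizontalLift π g' p v vh → IsHorizontalLift π g' p (S.φ a (π p) v) wh →
      J a p vh = wh + S.η a (π p) v • fundamentalField I' p
  vertical : ∀ (a : Fin 3) (p : P) (xh : TangentSpace I' p),
    IsHorizontalLift π g' p (S.ξ a (π p)) xh → J a p (fundamentalField I' p) = -xh

end Bundles

end ParaHyper

end

namespace ParaHyper

open Bundle

section HomBundle

theorem contMDiffAt_clm_of_apply {EM : Type*} [NormedAddCommGroup EM] [NormedSpace ℝ EM]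
    {HM : Type*} [TopologicalSpace HM] {IM : ModelWithCorners ℝ EM HM}
    {M : Type*} [TopologicalSpace M] [ChartedSpace HM M]
    {F₁ F₂ : Type*} [NormedAddCommGroup F₁] [NormedSpace ℝ F₁] [FiniteDimensional ℝ F₁]
    [NormedAddCommGroup F₂] [NormedSpace ℝ F₂] {n : WithTop ℕ∞}
    {f : M → F₁ →L[ℝ] F₂} {x₀ : M}
    (h : ∀ v, ContMDiffAt IM 𝓘(ℝ, F₂) n (fun x => f x v) x₀) :
    ContMDiffAt IM 𝓘(ℝ, F₁ →L[ℝ] F₂) n f x₀ := by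
  let c : F₁ ≃L[ℝ] (Fin (Module.finrank ℝ F₁) → ℝ) :=
    ContinuousLinearEquiv.ofFinrankEq (by simp)
  let e := (c.arrowCongr (1 : F₂ ≃L[ℝ] F₂)).trans (ContinuousLinearEquiv.piRing _)
  have he : ContMDiffAt IM 𝓘(ℝ, Fin (Module.finrank ℝ F₁) → F₂) n (fun x => e (f x)) x₀ := by
    rw [contMDiffAt_pi_space]
    intro i
    exact h _
  have := e.symm.contDiff.contMDiff.contMDiffAt.comp x₀ he
  exact this.congr_of_eventuallyEq (by simp [Function.comp_def])

variable {B F₁ F₂ : Type*} {n : WithTop ℕ∞}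
  {E₁ : B → Type*} {E₂ : B → Type*}
  [∀ x, AddCommGroup (E₁ x)] [∀ x, Module ℝ (E₁ x)] [NormedAddCommGroup F₁] [NormedSpace ℝ F₁]
  [TopologicalSpace (TotalSpace F₁ E₁)] [∀ x, TopologicalSpace (E₁ x)]
  [∀ x, AddCommGroup (E₂ x)]
  [∀ x, Module ℝ (E₂ x)] [NormedAddCommGroup F₂] [NormedSpace ℝ F₂]
  [TopologicalSpace (TotalSpace F₂ E₂)] [∀ x, TopologicalSpace (E₂ x)]
  {EB : Type*}
  [NormedAddCommGroup EB] [NormedSpace ℝ EB] {HB : Type*} [TopologicalSpace HB]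
  {IB : ModelWithCorners ℝ EB HB} [TopologicalSpace B] [ChartedSpace HB B]
  [FiberBundle F₁ E₁] [VectorBundle ℝ F₁ E₁]
  [FiberBundle F₂ E₂] [VectorBundle ℝ F₂ E₂]
  [∀ x, IsTopologicalAddGroup (E₂ x)] [∀ x, ContinuousSMul ℝ (E₂ x)]

theorem contMDiffAt_hom_of_frame [FiniteDimensional ℝ F₁]
    {φ : ∀ x, E₁ x →L[ℝ] E₂ x} {x₀ : B}
    (h : ∀ v : F₁, ContMDiffAt IB (IB.prod 𝓘(ℝ, F₂)) n
      (fun x => TotalSpace.mk' F₂ x (φ x ((trivializationAt F₁ E₁ x₀).symm x v))) x₀) :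
    ContMDiffAt IB (IB.prod 𝓘(ℝ, F₁ →L[ℝ] F₂)) n
      (fun x => TotalSpace.mk' (F₁ →L[ℝ] F₂) (E := fun x => E₁ x →L[ℝ] E₂ x) x (φ x)) x₀ := by
  rw [contMDiffAt_hom_bundle]
  refine ⟨contMDiffAt_id, contMDiffAt_clm_of_apply fun v => ?_⟩
  refine ((contMDiffAt_totalSpace.1 (h v)).2).congr_of_eventuallyEq ?_
  filter_upwards [(trivializationAt F₁ E₁ x₀).open_baseSet.mem_nhds
    (FiberBundle.mem_baseSet_trivializationAt' x₀),
    (trivializationAt F₂ E₂ x₀).open_baseSet.mem_nhds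
    (FiberBundle.mem_baseSet_trivializationAt' x₀)] with x hx₁ hx₂
  simp [ContinuousLinearMap.inCoordinates, Trivialization.coe_linearMapAt_of_mem _ hx₂,
    Trivialization.symmL_apply _ hx₁]

theorem contMDiffAt_frame [ContMDiffVectorBundle n F₁ E₁ IB]
    [∀ x, IsTopologicalAddGroup (E₁ x)] [∀ x, ContinuousSMul ℝ (E₁ x)] (x₀ : B) (v : F₁) :
    ContMDiffAt IB (IB.prod 𝓘(ℝ, F₁)) n
      (fun x => TotalSpace.mk' F₁ x ((trivializationAt F₁ E₁ x₀).symm x v)) x₀ := by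
  rw [(trivializationAt F₁ E₁ x₀).contMDiffAt_section_iff
    (FiberBundle.mem_baseSet_trivializationAt' x₀)]
  refine (contMDiffAt_const (c := v)).congr_of_eventuallyEq ?_
  filter_upwards [(trivializationAt F₁ E₁ x₀).open_baseSet.mem_nhds
    (FiberBundle.mem_baseSet_trivializationAt' x₀)] with x hx
  simp [Trivialization.apply_mk_symm _ hx]

end HomBundle

section Tensors

variable {E : Type*} [NormedAddCommGroup E] [NormedSpace ℝ E]
  {H : Type*} [TopologicalSpace H] {I : ModelWithCorners ℝ E H}
  {M : Type*} [TopologicalSpace M] [ChartedSpace H M] [IsManifold I ∞ M]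
  {E' : Type*} [NormedAddCommGroup E'] [NormedSpace ℝ E']
  {H' : Type*} [TopologicalSpace H'] {I' : ModelWithCorners ℝ E' H'}
  {P : Type*} [TopologicalSpace P] [ChartedSpace H' P]
  {b : P → M} {p₀ : P}

theorem OneForm.contMDiffAt_apply (η : OneForm I M) (hb : ContMDiffAt I' I ∞ b p₀)
    {X : ∀ p, TangentSpace I (b p)}
    (hX : ContMDiffAt I' (I.prod 𝓘(ℝ, E)) ∞ (fun p => TotalSpace.mk' E (b p) (X p)) p₀) :
    ContMDiffAt I' 𝓘(ℝ, ℝ) ∞ (fun p => η (b p) (X p)) p₀ := by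
  have h := ContMDiffAt.clm_bundle_apply (E₂ := Bundle.Trivial M ℝ)
    (ϕ := fun p => η (b p)) ((η.contMDiff (b p₀)).comp p₀ hb) hX
  exact (contMDiffAt_totalSpace.1 h).2

theorem BilinField.contMDiffAt_apply (g : BilinField I M) (hb : ContMDiffAt I' I ∞ b p₀)
    {X Y : ∀ p, TangentSpace I (b p)}
    (hX : ContMDiffAt I' (I.prod 𝓘(ℝ, E)) ∞ (fun p => TotalSpace.mk' E (b p) (X p)) p₀)
    (hY : ContMDiffAt I' (I.prod 𝓘(ℝ, E)) ∞ (fun p => TotalSpace.mk' E (b p) (Y p)) p₀) :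
    ContMDiffAt I' 𝓘(ℝ, ℝ) ∞ (fun p => g (b p) (X p) (Y p)) p₀ := by
  have h := ContMDiffAt.clm_bundle_apply₂ (E₃ := Bundle.Trivial M ℝ)
    (ψ := fun p => g (b p)) ((g.contMDiff (b p₀)).comp p₀ hb) hX hY
  exact (contMDiffAt_totalSpace.1 h).2

theorem EndField.contMDiffAt_apply (φ : EndField I M) (hb : ContMDiffAt I' I ∞ b p₀)
    {X : ∀ p, TangentSpace I (b p)}
    (hX : ContMDiffAt I' (I.prod 𝓘(ℝ, E)) ∞ (fun p => TotalSpace.mk' E (b p) (X p)) p₀) :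
    ContMDiffAt I' (I.prod 𝓘(ℝ, E)) ∞
      (fun p => TotalSpace.mk' E (b p) (φ (b p) (X p))) p₀ :=
  ContMDiffAt.clm_bundle_apply (ϕ := fun p => φ (b p)) ((φ.contMDiff (b p₀)).comp p₀ hb) hX

variable [FiniteDimensional ℝ E]

/-- A field of endomorphisms is smooth at a point if it maps vector fields that are smooth there
to vector fields that are smooth there. -/
theorem contMDiffAt_endField {J : ∀ x : M, TangentSpace I x →L[ℝ] TangentSpace I x} {x₀ : M}
    (h : ∀ X : ∀ x : M, TangentSpace I x,
      ContMDiffAt I (I.prod 𝓘(ℝ, E)) ∞ (fun x => TotalSpace.mk' E x (X x)) x₀ →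
      ContMDiffAt I (I.prod 𝓘(ℝ, E)) ∞ (fun x => TotalSpace.mk' E x (J x (X x))) x₀) :
    ContMDiffAt I (I.prod 𝓘(ℝ, E →L[ℝ] E)) ∞ (fun x => TotalSpace.mk' (E →L[ℝ] E)
      (E := fun x : M => TangentSpace I x →L[ℝ] TangentSpace I x) x (J x)) x₀ :=
  contMDiffAt_hom_of_frame fun v => h _ (contMDiffAt_frame x₀ v)

theorem contMDiffAt_oneForm {η : ∀ x : M, TangentSpace I x →L[ℝ] ℝ} {x₀ : M}
    (h : ∀ X : ∀ x : M, TangentSpace I x,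
      ContMDiffAt I (I.prod 𝓘(ℝ, E)) ∞ (fun x => TotalSpace.mk' E x (X x)) x₀ →
      ContMDiffAt I 𝓘(ℝ, ℝ) ∞ (fun x => η x (X x)) x₀) :
    ContMDiffAt I (I.prod 𝓘(ℝ, E →L[ℝ] ℝ)) ∞ (fun x => TotalSpace.mk' (E →L[ℝ] ℝ)
      (E := fun x : M => TangentSpace I x →L[ℝ] ℝ) x (η x)) x₀ :=
  contMDiffAt_hom_of_frame (E₂ := Bundle.Trivial M ℝ) fun v =>
    contMDiffAt_totalSpace.2 ⟨contMDiffAt_id, h _ (contMDiffAt_frame x₀ v)⟩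

theorem contMDiffAt_bilinField
    {β : ∀ x : M, TangentSpace I x →L[ℝ] TangentSpace I x →L[ℝ] ℝ} {x₀ : M}
    (h : ∀ X Y : ∀ x : M, TangentSpace I x,
      ContMDiffAt I (I.prod 𝓘(ℝ, E)) ∞ (fun x => TotalSpace.mk' E x (X x)) x₀ →
      ContMDiffAt I (I.prod 𝓘(ℝ, E)) ∞ (fun x => TotalSpace.mk' E x (Y x)) x₀ →
      ContMDiffAt I 𝓘(ℝ, ℝ) ∞ (fun x => β x (X x) (Y x)) x₀) :
    ContMDiffAt I (I.prod 𝓘(ℝ, E →L[ℝ] E →L[ℝ] ℝ)) ∞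
      (fun x => TotalSpace.mk' (E →L[ℝ] E →L[ℝ] ℝ)
        (E := fun x : M => TangentSpace I x →L[ℝ] TangentSpace I x →L[ℝ] ℝ) x (β x)) x₀ :=
  contMDiffAt_hom_of_frame (E₂ := fun x : M => TangentSpace I x →L[ℝ] Bundle.Trivial M ℝ x)
    fun v => contMDiffAt_oneForm fun Y hY => h _ Y (contMDiffAt_frame x₀ v) hY

end Tensors

end ParaHyper

namespace ParaHyper

open Bundle (TotalSpace)

section Circle

variable {E : Type*} [NormedAddCommGroup E] [NormedSpace ℝ E]
  {H : Type*} [TopologicalSpace H] {I : ModelWithCorners ℝ E H}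
  {M : Type*} [TopologicalSpace M] [ChartedSpace H M]
  {E' : Type*} [NormedAddCommGroup E'] [NormedSpace ℝ E']
  {H' : Type*} [TopologicalSpace H'] {I' : ModelWithCorners ℝ E' H'}
  {P : Type*} [TopologicalSpace P] [ChartedSpace H' P]

theorem mfderiv_apply_congr {f : P → M} {p q : P} (h : p = q) (u : E') :
    (mfderiv I' I f p : E' →L[ℝ] E) u = (mfderiv I' I f q : E' →L[ℝ] E) u := by
  rw [h]

variable [MulAction Circle P] {π : P → M}

/-- The derivative at `π p` of the local section of `π` through `p` given by the
trivialization `e`. -/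
noncomputable def localLift (I : ModelWithCorners ℝ E H) (I' : ModelWithCorners ℝ E' H')
    (e : Bundle.Trivialization Circle π) (p : P) :
    TangentSpace I (π p) →L[ℝ] TangentSpace I' p :=
  (mfderiv I I' (fun x : M => e.toOpenPartialHomeomorph.symm (x, (e p).2)) (π p) : E →L[ℝ] E')

namespace IsPrincipalCircleBundle

theorem surjective (hπ : IsPrincipalCircleBundle I I' π) : Function.Surjective π := by
  intro x
  obtain ⟨e, hx, -⟩ := hπ.locally_trivial x
  exact ⟨e.toOpenPartialHomeomorph.symm (x, 1), e.proj_symm_apply' hx⟩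

theorem contMDiff_orbit (hπ : IsPrincipalCircleBundle I I' π) :
    ContMDiff (𝓘(ℝ, ℝ).prod I') I' ∞ (fun q : ℝ × P => Circle.exp q.1 • q.2) :=
  hπ.smooth_action.comp ((contMDiff_circleExp.comp contMDiff_fst).prodMk contMDiff_snd)

theorem mdifferentiableAt_orbit (hπ : IsPrincipalCircleBundle I I' π) (p : P) (t : ℝ) :
    MDifferentiableAt 𝓘(ℝ, ℝ) I' (fun t : ℝ => Circle.exp t • p) t :=
  ((hπ.contMDiff_orbit.comp (contMDiff_id.prodMk contMDiff_const)).mdifferentiable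
    (by simp)) t

theorem mdifferentiableAt (hπ : IsPrincipalCircleBundle I I' π) (p : P) :
    MDifferentiableAt I' I π p :=
  hπ.smooth.mdifferentiable (by simp) p

theorem mfderiv_fundamentalField (hπ : IsPrincipalCircleBundle I I' π) (p : P) :
    mfderiv I' I π p (fundamentalField I' p) = 0 := by
  have h : mfderiv 𝓘(ℝ, ℝ) I (π ∘ fun t : ℝ => Circle.exp t • p) 0 = 0 := by
    have : (π ∘ fun t : ℝ => Circle.exp t • p) = fun _ => π p := by
      ext t; exact hπ.proj_smul _ _
    rw [this]; exact mfderiv_const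
  rw [mfderiv_comp 0 (hπ.mdifferentiableAt _) (hπ.mdifferentiableAt_orbit p 0)] at h
  have h1 := congrArg (fun L : ℝ →L[ℝ] E => L 1) h
  have hc : p = Circle.exp 0 • p := by simp
  exact (mfderiv_apply_congr hc _).trans h1

theorem fundamentalField_ne_zero (hπ : IsPrincipalCircleBundle I I' π) (p : P) :
    fundamentalField I' p ≠ 0 := by
  intro h0
  obtain ⟨e, hx, he, -, heq⟩ := hπ.locally_trivial (π p)
  have hp : p ∈ e.source := e.mem_source.2 hx
  have hc : Circle.exp 0 • p = p := by simp
  let F : P → ℂ := fun q => ((e q).2 : ℂ)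
  have hF : MDifferentiableAt I' 𝓘(ℝ, ℂ) F (Circle.exp 0 • p) := by
    rw [hc]
    have h1 : ContMDiffAt I' (I.prod (𝓡 1)) ∞ e p :=
      he.contMDiffAt (e.open_source.mem_nhds hp)
    have h2 : ContMDiffAt (𝓡 1) 𝓘(ℝ, ℂ) ∞ (fun z : Circle => (z : ℂ)) (e p).2 :=
      haveI : Fact (Module.finrank ℝ ℂ = 1 + 1) := ⟨Complex.finrank_real_complex⟩
      (contMDiff_coe_sphere (E := ℂ) (n := 1) (m := ∞)).contMDiffAt
    exact (h2.comp p (contMDiffAt_snd.comp p h1)).mdifferentiableAt (by simp)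
  have h := mfderiv_comp (I'' := 𝓘(ℝ, ℂ)) (g := F) (0 : ℝ) hF (hπ.mdifferentiableAt_orbit p 0)
  have hz : mfderiv 𝓘(ℝ, ℝ) 𝓘(ℝ, ℂ) (F ∘ fun t : ℝ => Circle.exp t • p) 0 (1 : ℝ) = 0 := by
    rw [h]
    refine (congrArg (mfderiv I' 𝓘(ℝ, ℂ) F (Circle.exp 0 • p)) h0).trans (map_zero _)
  have hfun : (F ∘ fun t : ℝ => Circle.exp t • p) =
      fun t : ℝ => Complex.exp (t * Complex.I) * ((e p).2 : ℂ) := by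
    ext t
    simp [F, heq _ p hp, Circle.coe_exp]
  have hd : HasDerivAt (fun t : ℝ => Complex.exp (t * Complex.I) * ((e p).2 : ℂ))
      (Complex.I * ((e p).2 : ℂ)) 0 := by
    have h1 : HasDerivAt (fun t : ℝ => (t : ℂ) * Complex.I) Complex.I 0 := by
      simpa using (Complex.ofRealCLM.hasDerivAt (x := (0 : ℝ))).mul_const Complex.I
    simpa using (h1.cexp).mul_const ((e p).2 : ℂ)
  rw [hfun, mfderiv_eq_fderiv] at hz
  have hz' : deriv (fun t : ℝ => Complex.exp (t * Complex.I) * ((e p).2 : ℂ)) 0 = 0 := by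
    rw [← fderiv_apply_one_eq_deriv]; exact hz
  rw [hd.deriv] at hz'
  simp at hz'

omit [MulAction Circle P] in
theorem contMDiffAt_symm_slice (e : Bundle.Trivialization Circle π)
    (he : ContMDiffOn (I.prod (𝓡 1)) I' ∞ e.toOpenPartialHomeomorph.symm e.target)
    {p : P} (hp : p ∈ e.source) :
    ContMDiffAt (I.prod (𝓡 1)) I' ∞ e.toOpenPartialHomeomorph.symm (π p, (e p).2) :=
  he.contMDiffAt (e.open_target.mem_nhds (e.mem_target.2 (e.mem_source.1 hp)))

omit [MulAction Circle P] in
theorem symm_apply_self (e : Bundle.Trivialization Circle π) {p : P} (hp : p ∈ e.source) :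
    e.toOpenPartialHomeomorph.symm (π p, (e p).2) = p := by
  rw [e.mk_proj_snd hp]
  exact e.toOpenPartialHomeomorph.left_inv hp

theorem mfderiv_localLift (hπ : IsPrincipalCircleBundle I I' π)
    (e : Bundle.Trivialization Circle π)
    (he : ContMDiffOn (I.prod (𝓡 1)) I' ∞ e.toOpenPartialHomeomorph.symm e.target)
    {p : P} (hp : p ∈ e.source) (v : TangentSpace I (π p)) :
    mfderiv I' I π p (localLift I I' e p v) = v := by
  let s : M → P := fun x : M => e.toOpenPartialHomeomorph.symm (x, (e p).2)
  have hs : MDifferentiableAt I I' s (π p) :=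
    ((contMDiffAt_symm_slice e he hp).comp (π p)
      (contMDiffAt_id.prodMk contMDiffAt_const)).mdifferentiableAt (by simp)
  have h : mfderiv I I (π ∘ s) (π p) = ContinuousLinearMap.id ℝ _ := by
    rw [← mfderiv_id]
    refine Filter.EventuallyEq.mfderiv_eq ?_
    filter_upwards [e.open_baseSet.mem_nhds (e.mem_source.1 hp)] with x hx
    exact e.proj_symm_apply' hx
  rw [mfderiv_comp (π p) (hπ.mdifferentiableAt _) hs] at h
  have h1 := congrArg (fun L : E →L[ℝ] E => L v) h
  exact (mfderiv_apply_congr (symm_apply_self e hp).symm _).trans h1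

theorem mfderiv_surjective (hπ : IsPrincipalCircleBundle I I' π) (p : P) :
    Function.Surjective (mfderiv I' I π p) := by
  obtain ⟨e, hx, -, he, -⟩ := hπ.locally_trivial (π p)
  exact fun v => ⟨_, hπ.mfderiv_localLift e he (e.mem_source.2 hx) v⟩

theorem exists_smul_fundamentalField (hπ : IsPrincipalCircleBundle I I' π) {p : P}
    {u : TangentSpace I' p} (hu : mfderiv I' I π p u = 0) :
    ∃ c : ℝ, u = c • fundamentalField I' p := by
  obtain ⟨e, hx, he', he, -⟩ := hπ.locally_trivial (π p)
  have hp : p ∈ e.source := e.mem_source.2 hx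
  let D : EuclideanSpace ℝ (Fin 1) →L[ℝ] E' :=
    mfderiv (𝓡 1) I' (fun z : Circle => e.toOpenPartialHomeomorph.symm (π p, z)) (e p).2
  have hker : ∀ w : E', (mfderiv I' I π p : E' →L[ℝ] E) w = 0 → w ∈ D.range := by
    intro w hw
    let f : P → M × Circle := fun q => (π q, (e q).2)
    have hsnd : MDifferentiableAt I' (𝓡 1) (fun q => (e q).2) p :=
      (contMDiffAt_snd.comp p
        (he'.contMDiffAt (e.open_source.mem_nhds hp))).mdifferentiableAt (by simp)
    have hf : MDifferentiableAt I' (I.prod (𝓡 1)) f p := (hπ.mdifferentiableAt p).prodMk hsnd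
    have hs : MDifferentiableAt (I.prod (𝓡 1)) I' e.toOpenPartialHomeomorph.symm (f p) :=
      (contMDiffAt_symm_slice e he hp).mdifferentiableAt (by simp)
    have h : mfderiv I' I' (e.toOpenPartialHomeomorph.symm ∘ f) p
        = ContinuousLinearMap.id ℝ _ := by
      rw [← mfderiv_id]
      refine Filter.EventuallyEq.mfderiv_eq ?_
      filter_upwards [e.open_source.mem_nhds hp] with q hq
      exact symm_apply_self e hq
    rw [mfderiv_comp p hs hf, mfderiv_prodMk (hπ.mdifferentiableAt p) hsnd] at h
    have h1 := congrArg (fun L : E' →L[ℝ] E' => L w) h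
    let w₁ : E := (mfderiv I' I π p : E' →L[ℝ] E) w
    let w₂ := (mfderiv I' (𝓡 1) (fun q => (e q).2) p : E' →L[ℝ] EuclideanSpace ℝ (Fin 1)) w
    have h2 := mfderiv_prod_eq_add_apply hs (v := ((w₁, w₂) : E × EuclideanSpace ℝ (Fin 1)))
    refine ⟨w₂, ?_⟩
    have h3 := h2.symm.trans h1
    refine Eq.trans ?_ h3
    have h4 := congrArg (mfderiv I I' (fun z => e.toOpenPartialHomeomorph.symm (z, (e p).2))
      (π p) : E →L[ℝ] E') hw
    replace h4 := h4.trans (map_zero _)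
    exact ((congrArg (· + D _) h4).trans (zero_add _)).symm
  have hrank : Module.finrank ℝ D.range ≤ 1 :=
    (LinearMap.finrank_range_le _).trans (by simp)
  obtain ⟨⟨d, hd⟩, hD⟩ := finrank_le_one_iff.1 hrank
  obtain ⟨a, ha⟩ := hD ⟨_, hker _ (hπ.mfderiv_fundamentalField p)⟩
  obtain ⟨c, hc⟩ := hD ⟨_, hker _ hu⟩
  have ha' : a • d = fundamentalField I' p := congrArg Subtype.val ha
  have hc' : c • d = u := congrArg Subtype.val hc
  have ha0 : a ≠ 0 := by
    rintro rfl
    exact hπ.fundamentalField_ne_zero p (ha'.symm.trans (zero_smul _ _))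
  refine ⟨c * a⁻¹, ?_⟩
  rw [← ha', ← hc']
  exact (by rw [smul_smul, inv_mul_cancel_right₀ ha0] : c • d = (c * a⁻¹) • a • d)

variable [IsManifold I ∞ M] [IsManifold I' ∞ P]

omit [IsManifold I ∞ M] in
theorem contMDiff_fundamentalField (hπ : IsPrincipalCircleBundle I I' π) :
    ContMDiff I' (I'.prod 𝓘(ℝ, E')) ∞
      (fun p => TotalSpace.mk' E' (E := fun p : P => TangentSpace I' p) p
        (fundamentalField I' p)) := by
  intro p₀
  let f : P → ℝ → P := fun p t => Circle.exp t • p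
  have hf : ContMDiffAt (I'.prod 𝓘(ℝ, ℝ)) I' ∞ (Function.uncurry f) (p₀, 0) :=
    (hπ.contMDiff_orbit.comp (contMDiff_snd.prodMk contMDiff_fst)).contMDiffAt
  have hb : ContMDiffAt I' I' ∞ (fun p => f p 0) p₀ := by simpa [f] using! contMDiffAt_id
  have h : ContMDiffAt I' 𝓘(ℝ, ℝ →L[ℝ] E') ∞ (fun p => ContinuousLinearMap.inCoordinates
      ℝ (TangentSpace 𝓘(ℝ, ℝ) (M := ℝ)) E' (TangentSpace I' (M := P)) 0 0 (f p₀ 0) (f p 0)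
      (mfderiv 𝓘(ℝ, ℝ) I' (f p) 0)) p₀ :=
    hf.mfderiv (m := ∞) f (fun _ => (0 : ℝ)) contMDiffAt_const (by simp)
  have hv : ContMDiffAt I' (𝓘(ℝ, ℝ).prod 𝓘(ℝ, ℝ)) ∞
      (fun _ : P => TotalSpace.mk' ℝ (E := TangentSpace 𝓘(ℝ, ℝ) (M := ℝ)) 0 (1 : ℝ)) p₀ :=
    contMDiffAt_const
  refine (h.clm_apply_of_inCoordinates (b₁ := fun _ => (0 : ℝ)) (b₂ := fun p => f p 0)
    hv hb).congr_of_eventuallyEq (Filter.Eventually.of_forall fun p => ?_)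
  have hbase : f p 0 = p := by simp [f]
  exact congrArg (fun q => (⟨q, (fundamentalField I' p : E')⟩ : TangentBundle I' P)) hbase.symm

theorem contMDiffAt_localLift (hπ : IsPrincipalCircleBundle I I' π)
    (e : Bundle.Trivialization Circle π)
    (he' : ContMDiffOn I' (I.prod (𝓡 1)) ∞ e e.source)
    (he : ContMDiffOn (I.prod (𝓡 1)) I' ∞ e.toOpenPartialHomeomorph.symm e.target)
    {p₀ : P} (hp₀ : p₀ ∈ e.source) {X : ∀ p, TangentSpace I (π p)}
    (hX : ContMDiffAt I' (I.prod 𝓘(ℝ, E)) ∞ (fun p => TotalSpace.mk' E (π p) (X p)) p₀) :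
    ContMDiffAt I' (I'.prod 𝓘(ℝ, E')) ∞
      (fun p => TotalSpace.mk' E' (E := fun p : P => TangentSpace I' p) p
        (localLift I I' e p (X p))) p₀ := by
  let f : P → M → P := fun p x => e.toOpenPartialHomeomorph.symm (x, (e p).2)
  have hsnd : ContMDiffAt I' (𝓡 1) ∞ (fun p => (e p).2) p₀ :=
    contMDiffAt_snd.comp p₀ (he'.contMDiffAt (e.open_source.mem_nhds hp₀))
  have hsnd' : ContMDiffAt (I'.prod I) (𝓡 1) ∞ ((fun p => (e p).2) ∘ Prod.fst) (p₀, π p₀) :=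
    ContMDiffAt.comp (p₀, π p₀) hsnd contMDiffAt_fst
  have hf : ContMDiffAt (I'.prod I) I' ∞ (Function.uncurry f) (p₀, π p₀) :=
    (contMDiffAt_symm_slice e he hp₀).comp (p₀, π p₀)
      (contMDiffAt_snd.prodMk hsnd')
  have hb : ContMDiffAt I' I' ∞ (fun p => f p (π p)) p₀ :=
    (contMDiffAt_symm_slice e he hp₀).comp p₀ (hπ.smooth.contMDiffAt.prodMk hsnd)
  have h : ContMDiffAt I' 𝓘(ℝ, E →L[ℝ] E') ∞ (fun p => ContinuousLinearMap.inCoordinates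
      E (TangentSpace I (M := M)) E' (TangentSpace I' (M := P)) (π p₀) (π p)
      (f p₀ (π p₀)) (f p (π p)) (mfderiv I I' (f p) (π p))) p₀ :=
    hf.mfderiv (m := ∞) f π hπ.smooth.contMDiffAt (by simp)
  refine (h.clm_apply_of_inCoordinates (b₁ := π) (b₂ := fun p => f p (π p))
    hX hb).congr_of_eventuallyEq ?_
  filter_upwards [e.open_source.mem_nhds hp₀] with p hp
  exact congrArg (fun q => (⟨q, (localLift I I' e p (X p) : E')⟩ : TangentBundle I' P))
    (symm_apply_self e hp).symm

theorem contMDiffAt_mfderiv (hπ : IsPrincipalCircleBundle I I' π) {p₀ : P}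
    {X : ∀ p : P, TangentSpace I' p}
    (hX : ContMDiffAt I' (I'.prod 𝓘(ℝ, E')) ∞ (fun p => TotalSpace.mk' E' p (X p)) p₀) :
    ContMDiffAt I' (I.prod 𝓘(ℝ, E)) ∞
      (fun p => TotalSpace.mk' E (E := fun x : M => TangentSpace I x) (π p)
        (mfderiv I' I π p (X p))) p₀ :=
  (hπ.smooth.contMDiff_tangentMap (m := ∞) (by simp)).contMDiffAt.comp p₀ hX

end IsPrincipalCircleBundle

end Circle

end ParaHyper

namespace ParaHyper

open Bundle (TotalSpace)

open scoped Topology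

/-- The pullback of a bilinear form on a tangent space by a linear map. -/
noncomputable def pullbackForm {E : Type*} [NormedAddCommGroup E] [NormedSpace ℝ E]
    {H : Type*} [TopologicalSpace H] {I : ModelWithCorners ℝ E H}
    {M : Type*} [TopologicalSpace M] [ChartedSpace H M]
    {E' : Type*} [NormedAddCommGroup E'] [NormedSpace ℝ E']
    {H' : Type*} [TopologicalSpace H'] {I' : ModelWithCorners ℝ E' H'}
    {P : Type*} [TopologicalSpace P] [ChartedSpace H' P] {x : M} {p : P}
    (β : TangentSpace I x →L[ℝ] TangentSpace I x →L[ℝ] ℝ)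
    (L : TangentSpace I' p →L[ℝ] TangentSpace I x) :
    TangentSpace I' p →L[ℝ] TangentSpace I' p →L[ℝ] ℝ :=
  (fun (β : E →L[ℝ] E →L[ℝ] ℝ) (L : E' →L[ℝ] E) => β.bilinearComp L L) β L

section Algebra

variable {E : Type*} [NormedAddCommGroup E] [NormedSpace ℝ E]
  {H : Type*} [TopologicalSpace H] {I : ModelWithCorners ℝ E H}
  {M : Type*} [TopologicalSpace M] [ChartedSpace H M] [IsManifold I ∞ M]

theorem eps_mul_self (a : Fin 3) : eps a * eps a = 1 := by
  fin_cases a <;> simp [eps]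

theorem eps_ne_zero (a : Fin 3) : eps a ≠ 0 := left_ne_zero_of_mul_eq_one (eps_mul_self a)

namespace IsAlmostContactType

variable {ε : ℝ} {φ : EndField I M} {ξ : VectorField I M} {η : OneForm I M}

theorem phi_phi_xi (h : IsAlmostContactType ε φ ξ η) (x : M) : φ x (φ x (ξ x)) = 0 := by
  rw [h.sq, h.eta_xi, neg_add_cancel]

theorem eta_phi_smul_xi (h : IsAlmostContactType ε φ ξ η) (x : M) (v : TangentSpace I x) :
    η x (φ x v) • ξ x = η x v • φ x (ξ x) := by
  have h1 := h.sq x (φ x v)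
  rw [h.sq x v, map_add, map_neg, map_smul, map_smul] at h1
  exact (add_left_cancel h1).symm

theorem phi_xi (h : IsAlmostContactType ε φ ξ η) (hε : ε ≠ 0) (x : M) : φ x (ξ x) = 0 := by
  have h1 := h.eta_phi_smul_xi x (φ x (ξ x))
  rw [h.phi_phi_xi, map_zero, zero_smul] at h1
  have h2 := h.eta_phi_smul_xi x (ξ x)
  rw [h.eta_xi] at h2
  rcases smul_eq_zero.1 h1.symm with h3 | h3
  · rw [h3, zero_smul] at h2
    exact (smul_eq_zero.1 h2.symm).resolve_left hε
  · exact h3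

theorem eta_phi (h : IsAlmostContactType ε φ ξ η) (hε : ε ≠ 0) (x : M) (v : TangentSpace I x) :
    η x (φ x v) = 0 := by
  have h1 := h.eta_phi_smul_xi x v
  rw [h.phi_xi hε, smul_zero] at h1
  refine (smul_eq_zero.1 h1).resolve_right fun h2 => hε ?_
  rw [← h.eta_xi x, h2, map_zero]

end IsAlmostContactType

/-- The endomorphism `(v, t) ↦ (φ_α v - t ξ_α, η_α(v))` of `T_x M × ℝ`. -/
noncomputable def MixedThreeStructure.prolong (S : MixedThreeStructure I M) (a : Fin 3) (x : M) :
    TangentSpace I x × ℝ →L[ℝ] TangentSpace I x × ℝ :=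
  (S.φ a x ∘L ContinuousLinearMap.fst ℝ _ ℝ
    - (ContinuousLinearMap.snd ℝ (TangentSpace I x) ℝ).smulRight (S.ξ a x)).prod
    (S.η a x ∘L ContinuousLinearMap.fst ℝ _ ℝ)

namespace MixedThreeStructure

variable (S : MixedThreeStructure I M)

theorem prolong_apply (a : Fin 3) (x : M) (v : TangentSpace I x) (t : ℝ) :
    S.prolong a x (v, t) = (S.φ a x v - t • S.ξ a x, S.η a x v) := rfl

theorem prolong_prolong_self (a : Fin 3) (x : M) (z : TangentSpace I x × ℝ) :
    S.prolong a x (S.prolong a x z) = -(eps a • z) := by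
  obtain ⟨v, t⟩ := z
  have h := S.contact a
  have hε := eps_ne_zero a
  simp only [prolong_apply, map_sub, map_smul, h.sq, h.eta_xi, h.phi_xi hε, h.eta_phi hε]
  ext <;> simp [mul_comm]

theorem prolong_one_zero (x : M) (z : TangentSpace I x × ℝ) :
    S.prolong 1 x (S.prolong 0 x z) = S.prolong 2 x z := by
  obtain ⟨v, t⟩ := z
  have h1 := S.phi_phi' 0 x v
  have h2 := S.phi_xi' 0 x
  have h3 := S.eta_phi' 0 x v
  have h4 := S.eta_xi_ne 1 0 (by decide) x
  simp only [zero_add, eps, Matrix.cons_val, neg_smul, one_smul, neg_mul, one_mul,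
    neg_inj] at h1 h2 h3
  simp only [prolong_apply, map_sub, map_smul, h2, h3, h4]
  ext
  · rw [neg_add_eq_iff_eq_add] at h1
    simp only [h1]
    abel
  · simp

theorem prolong_zero_one (x : M) (z : TangentSpace I x × ℝ) :
    -(S.prolong 0 x (S.prolong 1 x z)) = S.prolong 2 x z := by
  obtain ⟨v, t⟩ := z
  have h1 := S.phi_phi 0 x v
  have h2 := S.phi_xi 0 x
  have h3 := S.eta_phi 0 x v
  have h4 := S.eta_xi_ne 0 1 (by decide) x
  simp only [zero_add, eps, Matrix.cons_val, neg_smul, one_smul, neg_mul, one_mul] at h1 h2 h3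
  simp only [prolong_apply, map_sub, map_smul, h2, h3, h4]
  ext
  · simp only [Prod.fst_neg]
    rw [eq_neg_iff_add_eq_zero] at h1
    rw [← sub_eq_zero, ← neg_eq_zero, ← h1]
    simp only [smul_neg]
    abel
  · simp

theorem IsCompatible.prolong {S : MixedThreeStructure I M} {g : SemiRiemannianMetric I M}
    (hg : S.IsCompatible g) (a : Fin 3) (x : M) (z w : TangentSpace I x × ℝ) :
    g.val x (S.prolong a x z).1 (S.prolong a x w).1
      + (S.prolong a x z).2 * (S.prolong a x w).2
      = eps a * (g.val x z.1 w.1 + z.2 * w.2) := by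
  obtain ⟨v, t⟩ := z
  obtain ⟨w, s⟩ := w
  have h := S.contact a
  have hε := eps_ne_zero a
  have hξ (u : TangentSpace I x) : g.val x (S.ξ a x) u = S.η a x u := by
    rw [g.symm, hg.xi]
  simp only [prolong_apply, map_sub, map_smul, sub_apply,
    smul_apply, hg.phi_phi, hg.xi, hξ, h.eta_phi hε, h.eta_xi, smul_eq_mul]
  ring

end MixedThreeStructure

section Hypercomplex

variable {J : Fin 3 → EndField I M}

theorem isAlmostParaHypercomplex_of_mul {x₀ : M} {v₀ : TangentSpace I x₀} (hv₀ : v₀ ≠ 0)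
    (sq : ∀ (a : Fin 3) (x : M) (v : TangentSpace I x), J a x (J a x v) = -(eps a • v))
    (mul₁ : ∀ (x : M) (v : TangentSpace I x), J 1 x (J 0 x v) = J 2 x v)
    (mul₂ : ∀ (x : M) (v : TangentSpace I x), -(J 0 x (J 1 x v)) = J 2 x v) :
    IsAlmostParaHypercomplex J := by
  have sq₀ (x : M) (v : TangentSpace I x) : J 0 x (J 0 x v) = -v := by
    simpa [eps] using sq 0 x v
  have sq₁ (x : M) (v : TangentSpace I x) : J 1 x (J 1 x v) = v := by
    simpa [eps] using sq 1 x v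
  have sq₂ (x : M) (v : TangentSpace I x) : J 2 x (J 2 x v) = v := by
    simpa [eps] using sq 2 x v
  have h20 (x : M) (v : TangentSpace I x) : J 2 x (J 0 x v) = -J 1 x v := by
    rw [← mul₁, sq₀, map_neg]
  have h02 (x : M) (v : TangentSpace I x) : J 0 x (J 2 x v) = J 1 x v := by
    rw [← mul₂, map_neg, sq₀, neg_neg]
  have self_eq_neg {x : M} {v : TangentSpace I x} (h : v = -v) : v = 0 := by
    have h2 : (2 : ℝ) • v = 0 := by
      rw [two_smul]
      nth_rw 1 [h]
      exact neg_add_cancel v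
    exact (smul_eq_zero.1 h2).resolve_left two_ne_zero
  have h0 : J 0 x₀ v₀ ≠ 0 := by
    intro h
    have := sq₀ x₀ v₀
    rw [h, map_zero] at this
    exact hv₀ (neg_eq_zero.1 this.symm)
  have h1 : J 1 x₀ v₀ ≠ 0 := by
    intro h
    have := sq₁ x₀ v₀
    rw [h, map_zero] at this
    exact hv₀ this.symm
  refine ⟨sq₀, ⟨sq₁, fun h => h0 ?_, fun h => h0 ?_⟩, ⟨sq₂, fun h => h1 ?_, fun h => h1 ?_⟩,
    mul₁, mul₂⟩ <;> apply self_eq_neg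
  · have := mul₁ x₀ v₀
    rw [← mul₂, h, h] at this
    exact this
  · have := mul₁ x₀ v₀
    rw [← mul₂, h, h, map_neg, neg_neg] at this
    exact this.symm
  · have := h20 x₀ v₀
    rw [← h02, h, h] at this
    rw [← h02, h]
    exact this
  · have := h20 x₀ v₀
    rw [← h02, h, h, map_neg, neg_neg] at this
    rw [← h02, h, map_neg, neg_neg]
    exact this

theorem average_eq (h : SemiRiemannianMetric I M) (x : M) (u v : TangentSpace I x) :
    average J h x u v = (1 / 4) * (h.val x u v + (h.val x (J 0 x u) (J 0 x v)
      - h.val x (J 1 x u) (J 1 x v) - h.val x (J 2 x u) (J 2 x v))) := by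
  simp [average, Fin.sum_univ_three, eps, sub_eq_add_neg]

theorem IsAlmostParaHypercomplex.average_apply (hJ : IsAlmostParaHypercomplex J)
    (h : SemiRiemannianMetric I M) (a : Fin 3) (x : M) (u v : TangentSpace I x) :
    average J h x (J a x u) (J a x v) = eps a * average J h x u v := by
  have h00 (v : TangentSpace I x) := hJ.complex x v
  have h11 (v : TangentSpace I x) := hJ.product₁.sq x v
  have h22 (v : TangentSpace I x) := hJ.product₂.sq x v
  have h10 (v : TangentSpace I x) := hJ.mul₁ x v
  have h01 (v : TangentSpace I x) : J 0 x (J 1 x v) = -J 2 x v := by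
    rw [← hJ.mul₂ x v, neg_neg]
  have h20 (v : TangentSpace I x) : J 2 x (J 0 x v) = -J 1 x v := by
    rw [← h10, h00, map_neg]
  have h02 (v : TangentSpace I x) : J 0 x (J 2 x v) = J 1 x v := by
    rw [← hJ.mul₂ x v, map_neg, h00, neg_neg]
  have h12 (v : TangentSpace I x) : J 1 x (J 2 x v) = J 0 x v := by
    rw [← h10, h11]
  have h21 (v : TangentSpace I x) : J 2 x (J 1 x v) = -J 0 x v := by
    rw [← h10, h01, map_neg, h12]
  simp only [average_eq]
  fin_cases a <;>
    simp [eps, h00, h11, h22, h10, h01, h20, h02, h12, h21] <;> ring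

theorem IsParaHyperhermitian.average_apply {k : SemiRiemannianMetric I M}
    (hk : IsParaHyperhermitian J k) (x : M) (u v : TangentSpace I x) :
    average J k x u v = k.val x u v := by
  simp only [average_eq, hk _ x u v]
  simp [eps]
  ring

theorem exists_semiRiemannianMetric_average [FiniteDimensional ℝ E]
    (h : SemiRiemannianMetric I M)
    (hnd : ∀ (x : M) (u : TangentSpace I x),
      (∀ v : TangentSpace I x, average J h x u v = 0) → u = 0) :
    ∃ k : SemiRiemannianMetric I M,
      ∀ (x : M) (u v : TangentSpace I x), k.val x u v = average J h x u v := by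
  let pull (a : Fin 3) (x : M) : TangentSpace I x →L[ℝ] TangentSpace I x →L[ℝ] ℝ :=
    pullbackForm (h.val x) (J a x)
  let β (x : M) : TangentSpace I x →L[ℝ] TangentSpace I x →L[ℝ] ℝ :=
    (1 / 4 : ℝ) • (h.val x + (pull 0 x - pull 1 x - pull 2 x))
  have hβ (x : M) (u v : TangentSpace I x) : β x u v = average J h x u v := by
    rw [average_eq]
    rfl
  refine ⟨⟨⟨β, fun x₀ => contMDiffAt_bilinField fun X Y hX hY => ?_⟩, fun x u v => ?_,
    fun x u hu => hnd x u fun v => (hβ x u v).symm.trans (hu v)⟩, hβ⟩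
  · have hJ (a : Fin 3) := h.val.contMDiffAt_apply contMDiffAt_id
      ((J a).contMDiffAt_apply contMDiffAt_id hX) ((J a).contMDiffAt_apply contMDiffAt_id hY)
    exact contMDiffAt_const.mul ((h.val.contMDiffAt_apply contMDiffAt_id hX hY).add
      (((hJ 0).sub (hJ 1)).sub (hJ 2)))
  · refine (hβ x u v).trans (Eq.trans ?_ (hβ x v u).symm)
    simp only [average, h.symm x u v, h.symm x (J _ x u)]

end Hypercomplex

end Algebra

end ParaHyper

namespace ParaHyper

open Bundle (TotalSpace)

open scoped Topology

section Connection

variable {E : Type*} [NormedAddCommGroup E] [NormedSpace ℝ E]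
  {H : Type*} [TopologicalSpace H] {I : ModelWithCorners ℝ E H}
  {M : Type*} [TopologicalSpace M] [ChartedSpace H M] [IsManifold I ∞ M]
  {E' : Type*} [NormedAddCommGroup E'] [NormedSpace ℝ E'] [FiniteDimensional ℝ E']
  {H' : Type*} [TopologicalSpace H'] {I' : ModelWithCorners ℝ E' H'}
  {P : Type*} [TopologicalSpace P] [ChartedSpace H' P] [IsManifold I' ∞ P]

/-- A nowhere vanishing vector field is dual to some 1-form. -/
theorem exists_oneForm_apply_eq_one [T2Space P] [SigmaCompactSpace P]
    {Z : ∀ p : P, TangentSpace I' p}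
    (hZ : ContMDiff I' (I'.prod 𝓘(ℝ, E')) ∞ (fun p => TotalSpace.mk' E' p (Z p)))
    (hZ0 : ∀ p, Z p ≠ 0) :
    ∃ θ : OneForm I' P, ∀ p, θ p (Z p) = 1 := by
  refine exists_contMDiffSection_forall_mem_convex_of_local (n := (⊤ : ℕ∞)) I'
    (fun p : P => TangentSpace I' p →L[ℝ] ℝ) (fun p => {θ | θ (Z p) = 1}) (fun p => ?_)
    fun p₀ => ?_
  · intro α hα β hβ a b _ _ hab
    simp only [Set.mem_ofPred_eq] at hα hβ ⊢
    simp [hα, hβ, hab]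
  · let τ := trivializationAt E' (TangentSpace I' : P → Type _) p₀
    have hp₀ : p₀ ∈ τ.baseSet := FiberBundle.mem_baseSet_trivializationAt' p₀
    have hτ0 : τ.continuousLinearEquivAt ℝ p₀ hp₀ (Z p₀) ≠ 0 :=
      (map_ne_zero_iff _ (τ.continuousLinearEquivAt ℝ p₀ hp₀).injective).2 (hZ0 p₀)
    obtain ⟨ℓ, hℓ⟩ := SeparatingDual.exists_ne_zero (R := ℝ) hτ0
    let κ (p : P) : TangentSpace I' p →L[ℝ] ℝ := ℓ ∘L τ.continuousLinearMapAt ℝ p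
    have hκ (X : ∀ p : P, TangentSpace I' p) (p : P) (hp : p ∈ τ.baseSet)
        (hX : ContMDiffAt I' (I'.prod 𝓘(ℝ, E')) ∞ (fun p => TotalSpace.mk' E' p (X p)) p) :
        ContMDiffAt I' 𝓘(ℝ, ℝ) ∞ (fun p => κ p (X p)) p := by
      refine (ℓ.contDiff.contMDiff.contMDiffAt.comp p
        ((τ.contMDiffAt_section_iff hp).1 hX)).congr_of_eventuallyEq ?_
      filter_upwards [τ.open_baseSet.mem_nhds hp] with q hq
      simp [κ, Bundle.Trivialization.coe_linearMapAt_of_mem _ hq]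
    have hne : κ p₀ (Z p₀) ≠ 0 := by
      simpa [κ, Bundle.Trivialization.coe_linearMapAt_of_mem _ hp₀] using hℓ
    refine ⟨{p | p ∈ τ.baseSet ∧ κ p (Z p) ≠ 0}, Filter.inter_mem (τ.open_baseSet.mem_nhds hp₀)
      ((hκ Z p₀ hp₀ (hZ p₀)).continuousAt.eventually_ne hne),
      fun p => (κ p (Z p))⁻¹ • κ p, fun p hp => ?_, fun p hp => ?_⟩
    · refine (contMDiffAt_oneForm fun X hX => ?_).contMDiffWithinAt
      exact ((hκ Z p hp.1 (hZ p)).inv₀ hp.2).mul (hκ X p hp.1 hX)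
    · exact inv_mul_cancel₀ hp.2

variable [MulAction Circle P] {π : P → M}

namespace IsPrincipalCircleBundle

variable (hπ : IsPrincipalCircleBundle I I' π)
  {θ : OneForm I' P} (hθ : ∀ p, θ p (fundamentalField I' p) = 1)

include hπ hθ in
omit [IsManifold I ∞ M] [FiniteDimensional ℝ E'] in
theorem bijective_mfderiv_prod (p : P) :
    Function.Bijective ((mfderiv I' I π p).prod (θ p)) := by
  constructor
  · rw [injective_iff_map_eq_zero]
    intro u hu
    have h1 : mfderiv I' I π p u = 0 := congrArg Prod.fst hu
    have h2 : θ p u = 0 := congrArg Prod.snd hu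
    obtain ⟨c, rfl⟩ := hπ.exists_smul_fundamentalField h1
    rw [map_smul, hθ, smul_eq_mul, mul_one] at h2
    rw [h2, zero_smul]
  · rintro ⟨v, t⟩
    obtain ⟨u, rfl⟩ := hπ.mfderiv_surjective p v
    refine ⟨u + (t - θ p u) • fundamentalField I' p, ?_⟩
    rw [map_add, map_smul]
    ext
    · simp [hπ.mfderiv_fundamentalField]
    · simp [hθ]

/-- The isomorphism `T_p P ≃ T_{π p} M × ℝ` given by `dπ` and a 1-form `θ` with `θ(Θ) = 1`. -/
noncomputable def splitting (p : P) :
    TangentSpace I' p ≃L[ℝ] TangentSpace I (π p) × ℝ :=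
  haveI : FiniteDimensional ℝ (TangentSpace I' p) := inferInstanceAs (FiniteDimensional ℝ E')
  haveI : T2Space (TangentSpace I' p) := inferInstanceAs (T2Space E')
  haveI : T2Space (TangentSpace I (π p)) := inferInstanceAs (T2Space E)
  (LinearEquiv.ofBijective ((mfderiv I' I π p).prod (θ p)).toLinearMap
    (hπ.bijective_mfderiv_prod hθ p)).toContinuousLinearEquiv

omit [IsManifold I ∞ M] in
theorem splitting_apply (p : P) (u : TangentSpace I' p) :
    hπ.splitting hθ p u = (mfderiv I' I π p u, θ p u) := rfl

omit [IsManifold I ∞ M] in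
theorem splitting_fundamentalField (p : P) :
    hπ.splitting hθ p (fundamentalField I' p) = (0, 1) := by
  rw [splitting_apply, hπ.mfderiv_fundamentalField, hθ]

omit [IsManifold I ∞ M] in
theorem splitting_symm_zero_one (p : P) :
    (hπ.splitting hθ p).symm (0, 1) = fundamentalField I' p := by
  rw [ContinuousLinearEquiv.symm_apply_eq, splitting_fundamentalField]

omit [IsManifold I ∞ M] in
theorem mfderiv_splitting_symm (p : P) (z : TangentSpace I (π p) × ℝ) :
    mfderiv I' I π p ((hπ.splitting hθ p).symm z) = z.1 :=
  congrArg Prod.fst ((hπ.splitting hθ p).apply_symm_apply z)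

omit [IsManifold I ∞ M] in
theorem oneForm_splitting_symm (p : P) (z : TangentSpace I (π p) × ℝ) :
    θ p ((hπ.splitting hθ p).symm z) = z.2 :=
  congrArg Prod.snd ((hπ.splitting hθ p).apply_symm_apply z)

theorem contMDiffAt_splitting_symm {p₀ : P} {X : ∀ p, TangentSpace I (π p)}
    (hX : ContMDiffAt I' (I.prod 𝓘(ℝ, E)) ∞ (fun p => TotalSpace.mk' E (π p) (X p)) p₀) :
    ContMDiffAt I' (I'.prod 𝓘(ℝ, E')) ∞
      (fun p => TotalSpace.mk' E' (E := fun p : P => TangentSpace I' p) p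
        ((hπ.splitting hθ p).symm (X p, 0))) p₀ := by
  obtain ⟨e, hx, he', he, -⟩ := hπ.locally_trivial (π p₀)
  have hp₀ : p₀ ∈ e.source := e.mem_source.2 hx
  have hL := hπ.contMDiffAt_localLift e he' he hp₀ hX
  have hΘ := (hπ.contMDiff_fundamentalField (I' := I')).contMDiffAt (x := p₀)
  refine (hL.sub_section
    ((θ.contMDiffAt_apply contMDiffAt_id hL).smul_section hΘ)).congr_of_eventuallyEq ?_
  filter_upwards [e.open_source.mem_nhds hp₀] with p hp
  congr 1
  rw [ContinuousLinearEquiv.symm_apply_eq]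
  simp only [Pi.sub_apply, Pi.smul_apply', map_sub, map_smul, splitting_fundamentalField]
  rw [splitting_apply, hπ.mfderiv_localLift e he hp]
  simp

variable (S : MixedThreeStructure I M)

/-- The endomorphism field `J_α` determined by `J_α X^h = (φ_α X)^h + η_α(X) Θ` and
`J_α Θ = -(ξ_α)^h`, where horizontal vectors are the kernel of `θ`. -/
noncomputable def liftedTriple (a : Fin 3) : EndField I' P where
  toFun p := ((hπ.splitting hθ p).symm : TangentSpace I (π p) × ℝ →L[ℝ] TangentSpace I' p) ∘L
    S.prolong a (π p) ∘L
      (hπ.splitting hθ p : TangentSpace I' p →L[ℝ] TangentSpace I (π p) × ℝ)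
  contMDiff_toFun := by
    refine fun p₀ => contMDiffAt_endField fun X hX => ?_
    have hb := hπ.smooth.contMDiffAt (x := p₀)
    have hdX := hπ.contMDiffAt_mfderiv hX
    have hφ := hπ.contMDiffAt_splitting_symm hθ ((S.φ a).contMDiffAt_apply hb hdX)
    have hη := (S.η a).contMDiffAt_apply hb hdX
    have hξ := hπ.contMDiffAt_splitting_symm hθ (X := fun p => S.ξ a (π p))
      (((S.ξ a).contMDiff (π p₀)).comp p₀ hb)
    have hΘ := (hπ.contMDiff_fundamentalField (I' := I')).contMDiffAt (x := p₀)
    refine ((hφ.sub_section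
      ((θ.contMDiffAt_apply contMDiffAt_id hX).smul_section hξ)).add_section
      (hη.smul_section hΘ)).congr_of_eventuallyEq (Filter.Eventually.of_forall fun p => ?_)
    refine congrArg (TotalSpace.mk' E' (E := fun p : P => TangentSpace I' p) p) ?_
    simp only [ContinuousLinearMap.comp_apply, ContinuousLinearEquiv.coe_coe]
    rw [ContinuousLinearEquiv.symm_apply_eq]
    simp only [Pi.add_apply, Pi.sub_apply, Pi.smul_apply', map_add, map_sub, map_smul,
      splitting_fundamentalField, ContinuousLinearEquiv.apply_symm_apply]
    rw [splitting_apply, S.prolong_apply]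
    simp

theorem splitting_liftedTriple (a : Fin 3) (p : P) (u : TangentSpace I' p) :
    hπ.splitting hθ p (hπ.liftedTriple hθ S a p u)
      = S.prolong a (π p) (hπ.splitting hθ p u) :=
  (hπ.splitting hθ p).apply_symm_apply _

theorem isAlmostParaHypercomplex_liftedTriple [Nonempty P] :
    IsAlmostParaHypercomplex (hπ.liftedTriple hθ S) := by
  obtain ⟨p₀⟩ := ‹Nonempty P›
  refine isAlmostParaHypercomplex_of_mul (hπ.fundamentalField_ne_zero p₀)
    (fun a p v => ?_) (fun p v => ?_) (fun p v => ?_) <;>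
    apply (hπ.splitting hθ p).injective
  · simp only [splitting_liftedTriple, S.prolong_prolong_self, map_neg, map_smul]
  · simp only [splitting_liftedTriple, S.prolong_one_zero]
  · rw [map_neg]
    simp only [splitting_liftedTriple, S.prolong_zero_one]

variable (g : SemiRiemannianMetric I M)

/-- The metric `π^* g + θ ⊗ θ`. -/
noncomputable def bundleMetric : SemiRiemannianMetric I' P where
  val :=
    { toFun := fun p => pullbackForm (g.val (π p)) (mfderiv I' I π p)
        + (θ p).smulRight (θ p)
      contMDiff_toFun := by
        refine fun p₀ => contMDiffAt_bilinField fun X Y hX hY => ?_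
        exact (g.val.contMDiffAt_apply hπ.smooth.contMDiffAt
          (hπ.contMDiffAt_mfderiv hX) (hπ.contMDiffAt_mfderiv hY)).add
          ((θ.contMDiffAt_apply contMDiffAt_id hX).mul (θ.contMDiffAt_apply contMDiffAt_id hY)) }
  symm p u v := congrArg₂ (· + ·) (g.symm _ _ _) (mul_comm (θ p u) (θ p v))
  nondegenerate p u hu := by
    have hu' (v : TangentSpace I' p) : g.val (π p) (mfderiv I' I π p u) (mfderiv I' I π p v)
        + θ p u * θ p v = 0 := hu v
    apply (hπ.splitting hθ p).injective
    rw [map_zero, splitting_apply]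
    have h1 : mfderiv I' I π p u = 0 := by
      refine g.nondegenerate _ _ fun v => ?_
      simpa [mfderiv_splitting_symm, oneForm_splitting_symm] using
        hu' ((hπ.splitting hθ p).symm (v, 0))
    have h2 : θ p u = 0 := by
      simpa [hπ.mfderiv_fundamentalField, hθ] using hu' (fundamentalField I' p)
    rw [h1, h2]
    rfl

theorem bundleMetric_apply (p : P) (u v : TangentSpace I' p) :
    (hπ.bundleMetric hθ g).val p u v
      = g.val (π p) (mfderiv I' I π p u) (mfderiv I' I π p v) + θ p u * θ p v := rfl

variable {S g}

theorem isParaHyperhermitian_bundleMetric (hg : S.IsCompatible g) :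
    IsParaHyperhermitian (hπ.liftedTriple hθ S) (hπ.bundleMetric hθ g) := by
  intro a p u v
  have h := hg.prolong a (π p) (hπ.splitting hθ p u) (hπ.splitting hθ p v)
  simp only [← splitting_liftedTriple] at h
  exact h

theorem isSemiRiemannianSubmersion_bundleMetric :
    IsSemiRiemannianSubmersion π (hπ.bundleMetric hθ g) g := by
  have hor {p : P} {u : TangentSpace I' p} (hu : IsHorizontal I π (hπ.bundleMetric hθ g) p u) :
      θ p u = 0 := by
    simpa [bundleMetric_apply, hπ.mfderiv_fundamentalField, hθ] using
      hu _ (hπ.mfderiv_fundamentalField p)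
  refine ⟨hπ.smooth, hπ.surjective, hπ.mfderiv_surjective, fun p w hw hw' => ?_,
    fun p u v hu hv => ?_⟩
  · apply (hπ.splitting hθ p).injective
    rw [map_zero, splitting_apply, hw, hor hw']
    rfl
  · rw [bundleMetric_apply, hor hu, zero_mul, add_zero]

end IsPrincipalCircleBundle

section Submersion

variable {g : SemiRiemannianMetric I M} {g' : SemiRiemannianMetric I' P}

namespace IsPrincipalCircleBundle

variable (hπ : IsPrincipalCircleBundle I I' π)

include hπ in
omit [FiniteDimensional ℝ E'] [IsManifold I ∞ M] in
theorem isHorizontal_iff {p : P} {u : TangentSpace I' p} :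
    IsHorizontal I π g' p u ↔ g'.val p u (fundamentalField I' p) = 0 := by
  refine ⟨fun h => h _ (hπ.mfderiv_fundamentalField p), fun h w hw => ?_⟩
  obtain ⟨c, rfl⟩ := hπ.exists_smul_fundamentalField hw
  rw [map_smul, h, smul_zero]

include hπ in
/-- The vertical 1-form of a semi-Riemannian submersion, normalized on `Θ`. -/
theorem exists_oneForm_isHorizontal (hg' : IsSemiRiemannianSubmersion π g' g) :
    ∃ θ : OneForm I' P, (∀ p, θ p (fundamentalField I' p) = 1) ∧
      ∀ (p : P) (u : TangentSpace I' p), IsHorizontal I π g' p u ↔ θ p u = 0 := by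
  have hne (p : P) : g'.val p (fundamentalField I' p) (fundamentalField I' p) ≠ 0 := fun h =>
    hπ.fundamentalField_ne_zero p (hg'.fibre_nondegenerate p _ (hπ.mfderiv_fundamentalField p)
      (hπ.isHorizontal_iff.2 h))
  have hΘ := hπ.contMDiff_fundamentalField (I' := I')
  refine ⟨⟨fun p => (g'.val p (fundamentalField I' p) (fundamentalField I' p))⁻¹ •
    g'.val p (fundamentalField I' p), fun p₀ => contMDiffAt_oneForm fun X hX => ?_⟩,
    fun p => inv_mul_cancel₀ (hne p), fun p u => ?_⟩
  · exact ((g'.val.contMDiffAt_apply contMDiffAt_id (hΘ p₀) (hΘ p₀)).inv₀ (hne p₀)).mul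
      (g'.val.contMDiffAt_apply contMDiffAt_id (hΘ p₀) hX)
  · rw [hπ.isHorizontal_iff, g'.symm]
    exact (mul_eq_zero_iff_left (inv_ne_zero (hne p))).symm

variable {θ : OneForm I' P} (hθ : ∀ p, θ p (fundamentalField I' p) = 1)
  (hor : ∀ (p : P) (u : TangentSpace I' p), IsHorizontal I π g' p u ↔ θ p u = 0)

include hor in
omit [IsManifold I ∞ M] in
theorem isHorizontalLift_iff {p : P} {v : TangentSpace I (π p)} {u : TangentSpace I' p} :
    IsHorizontalLift π g' p v u ↔ u = (hπ.splitting hθ p).symm (v, 0) := by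
  rw [ContinuousLinearEquiv.eq_symm_apply, splitting_apply, Prod.mk.injEq, IsHorizontalLift, hor]

include hor in
theorem isLiftedTriple_iff {S : MixedThreeStructure I M} {J : Fin 3 → EndField I' P} :
    IsLiftedTriple π g' S J ↔ J = hπ.liftedTriple hθ S := by
  constructor
  · intro hJ
    funext a
    ext p : 1
    refine ContinuousLinearMap.ext fun u => ?_
    obtain ⟨⟨v, t⟩, rfl⟩ := (hπ.splitting hθ p).symm.surjective u
    have hsplit : (hπ.splitting hθ p).symm (v, t)
        = (hπ.splitting hθ p).symm (v, 0) + t • fundamentalField I' p := by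
      rw [← hπ.splitting_symm_zero_one hθ, ← map_smul, ← map_add]
      simp
    have h1 := hJ.horizontal a p v _ _ ((hπ.isHorizontalLift_iff hθ hor).2 rfl)
      ((hπ.isHorizontalLift_iff hθ hor).2 rfl)
    have h2 := hJ.vertical a p _ ((hπ.isHorizontalLift_iff hθ hor).2 rfl)
    apply (hπ.splitting hθ p).injective
    rw [splitting_liftedTriple, ContinuousLinearEquiv.apply_symm_apply, hsplit, map_add, map_smul,
      h1, h2, S.prolong_apply]
    simp [splitting_fundamentalField, sub_eq_add_neg]
  · rintro rfl
    refine ⟨fun a p v vh wh hv hw => ?_, fun a p xh hx => ?_⟩ <;>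
      apply (hπ.splitting hθ p).injective <;> rw [splitting_liftedTriple]
    · rw [(hπ.isHorizontalLift_iff hθ hor).1 hv, (hπ.isHorizontalLift_iff hθ hor).1 hw]
      simp [splitting_fundamentalField, S.prolong_apply]
    · rw [(hπ.isHorizontalLift_iff hθ hor).1 hx]
      simp [splitting_fundamentalField, S.prolong_apply]

end IsPrincipalCircleBundle

end Submersion

end Connection

end ParaHyper

theorem theorem5p1
    {E : Type*} [NormedAddCommGroup E] [NormedSpace ℝ E] [FiniteDimensional ℝ E]
    {H : Type*} [TopologicalSpace H] (I : ModelWithCorners ℝ E H) [I.Boundaryless]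
    {M : Type*} [TopologicalSpace M] [ChartedSpace H M] [IsManifold I ∞ M]
    [T2Space M] [SigmaCompactSpace M] [Nonempty M]
    {E' : Type*} [NormedAddCommGroup E'] [NormedSpace ℝ E'] [FiniteDimensional ℝ E']
    {H' : Type*} [TopologicalSpace H'] (I' : ModelWithCorners ℝ E' H') [I'.Boundaryless]
    {P : Type*} [TopologicalSpace P] [ChartedSpace H' P] [IsManifold I' ∞ P]
    [T2Space P] [SigmaCompactSpace P]
    [MulAction Circle P] (π : P → M)
    (hπ : ParaHyper.IsPrincipalCircleBundle I I' π)
    (S : ParaHyper.MixedThreeStructure I M) (g : ParaHyper.SemiRiemannianMetric I M)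
    (hg : S.IsCompatible g) :
    -- `P` carries an almost para-hyperhermitian structure
    (∃ (J : Fin 3 → ParaHyper.EndField I' P) (k : ParaHyper.SemiRiemannianMetric I' P),
      ParaHyper.IsAlmostParaHyperhermitian J k) ∧
    -- there are metrics on `P` making `π` a semi-Riemannian submersion
    (∃ g' : ParaHyper.SemiRiemannianMetric I' P,
      ParaHyper.IsSemiRiemannianSubmersion π g' g) ∧
    -- and for each of them the horizontal lift formulas define such a structure
    ∀ g' : ParaHyper.SemiRiemannianMetric I' P,
      ParaHyper.IsSemiRiemannianSubmersion π g' g →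
      (∀ (p : P) (v : TangentSpace I (π p)),
        ∃! u : TangentSpace I' p, ParaHyper.IsHorizontalLift π g' p v u) ∧
      ∃ J : Fin 3 → ParaHyper.EndField I' P,
        ParaHyper.IsLiftedTriple π g' S J ∧
        (∀ J' : Fin 3 → ParaHyper.EndField I' P,
          ParaHyper.IsLiftedTriple π g' S J' → J' = J) ∧
        ParaHyper.IsAlmostParaHypercomplex J ∧
        -- averaging a metric gives a `J`-compatible tensor, which is a para-hyperhermitian
        -- metric as soon as it is nondegenerate
        (∀ h : ParaHyper.SemiRiemannianMetric I' P,
          (∀ (a : Fin 3) (p : P) (u v : TangentSpace I' p),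
            ParaHyper.average J h p (J a p u) (J a p v)
              = ParaHyper.eps a * ParaHyper.average J h p u v) ∧
          ((∀ (p : P) (u : TangentSpace I' p),
              (∀ v : TangentSpace I' p, ParaHyper.average J h p u v = 0) → u = 0) →
            ∃ k : ParaHyper.SemiRiemannianMetric I' P,
              (∀ (p : P) (u v : TangentSpace I' p),
                k.val p u v = ParaHyper.average J h p u v) ∧
              ParaHyper.IsAlmostParaHyperhermitian J k)) ∧
        -- and a para-hyperhermitian metric does arise in this way
        (∃ h k : ParaHyper.SemiRiemannianMetric I' P,
          (∀ (p : P) (u v : TangentSpace I' p),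
            k.val p u v = ParaHyper.average J h p u v) ∧
          ParaHyper.IsAlmostParaHyperhermitian J k) := by
  have hP : Nonempty P := hπ.surjective.nonempty
  obtain ⟨θ₀, hθ₀⟩ := ParaHyper.exists_oneForm_apply_eq_one
    (hπ.contMDiff_fundamentalField (I' := I')) hπ.fundamentalField_ne_zero
  refine ⟨⟨_, _, hπ.isAlmostParaHypercomplex_liftedTriple hθ₀ S,
    hπ.isParaHyperhermitian_bundleMetric hθ₀ hg⟩,
    ⟨_, hπ.isSemiRiemannianSubmersion_bundleMetric hθ₀⟩, fun g' hg' => ?_⟩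
  obtain ⟨θ, hθ, hor⟩ := hπ.exists_oneForm_isHorizontal hg'
  have hJ := hπ.isAlmostParaHypercomplex_liftedTriple hθ S
  have hk := hπ.isParaHyperhermitian_bundleMetric hθ hg
  refine ⟨fun p v => ⟨_, (hπ.isHorizontalLift_iff hθ hor).2 rfl,
      fun u hu => (hπ.isHorizontalLift_iff hθ hor).1 hu⟩,
    hπ.liftedTriple hθ S, (hπ.isLiftedTriple_iff hθ hor).2 rfl,
    fun J' hJ' => (hπ.isLiftedTriple_iff hθ hor).1 hJ', hJ, fun h => ⟨hJ.average_apply h,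
      fun hnd => ?_⟩, hπ.bundleMetric hθ g, hπ.bundleMetric hθ g,
    fun p u v => (hk.average_apply p u v).symm, hJ, hk⟩
  obtain ⟨k, hk⟩ := ParaHyper.exists_semiRiemannianMetric_average h hnd
  refine ⟨k, hk, hJ, fun a p u v => ?_⟩
  rw [hk, hk, hJ.average_apply]
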